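/- **Setting.** Let $\mathbb R^\infty$ be the space of finitely supported real sequences with its standard inner product. For a finite set $\iota$ let $L_\iota$ be the space (compact-open topology) of linear isometric embeddings $\bigoplus_{i\in\iota}\mathbb R^\infty\to\mathbb R^\infty$ of the orthogonal sum, so that $L_n=L_{\{1,\dots,n\}}$ is the $n$-th space of the linear isometries operad, with composition $\gamma(\ell;(m_i)_i)=\ell\circ\bigoplus_i m_i$. Let $G\subset O(k)$ be a closed subgroup, let $E$ be the Stiefel space of orthonormal $k$-frames in $\mathbb R^\infty$, on which $G$ acts by substitution, and let $X=BG=E/G$. A space over $BG$ is presented as $Y=P/G$, where $P$ is the principal $G$-bundle over $Y$ pulled back from $E\to BG$; a map of spaces over $BG$ is a continuous map of bases covered by a continuous $G$-equivariant map of these bundles. The join over $BG$ is $P_1/G*\cdots*P_n/G=(P_1*\cdots*P_n)/G$ with the diagonal action. A point of the join $P_1*\cdots*P_n$ is given by barycentric coordinates $t_i\ge 0$, $\sum t_i=1$, together with a point of $P_i$ for each $i$ with $t_i>0$ (nothing is remembered where $t_i=0$). The topology is the coarsest one making the coordinates $t_i$, and the coordinates in $P_i$ on the open sets $\{t_i>0\}$,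 continuous. (For $n=2$, a point of $Y*Z$ with $0<t<1$ is a triple $(t,y,z)$ with a $G$-isomorphism from the bundle fibre over $y$ to that over $z$; so the path space of $BG$ is replaced by its model with fibre $G$.) A constant space $W$ has the trivial bundle: $W\times(P/G)=(W\times P)/G$. In particular $X^{*\iota}=(E^{*\iota})/G$, and iterated joins are identified with multiple joins by multiplying barycentric coordinates. The *moving map* $\prod_i W_i\times(*_iY_i)\to *_i(W_i\times Y_i)$, for constant spaces $W_i$, forgets the coordinate in $W_i$ whenever $t_i=0$; for two factors with $W_2$ a point it is the map $W\times(Y*Z)\to(W\times Y)*Z$. The *structure map* $\theta_\iota:L_\iota\times X^{*\iota}\to X$ is the join inside $\mathbb R^\infty$: it sends $\ell=(\ell_i)_i$ and the class of $(t_i,v_i)_i$ to the class of the frame $\sum_i\sqrt{t_i}\,\ell_i(v_i)$. **Proposition.** Let $\iota$ and $\kappa_i$ ($i\in\iota$) be finite sets and let $\Sigma\kappa=\bigsqcup_i\kappa_i$. Consider the diagram with upper path $$L_\iota\times\Bigl(\prod_i L_{\kappa_i}\times\bigl(*_iX^{*\kappa_i}\bigr)\Bigr)\longrightarrow L_\iota\times\bigl(*_i(L_{\kappa_i}\times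 X^{*\kappa_i})\bigr)\longrightarrow L_\iota\times X^{*\iota}\longrightarrow X,$$ given by the moving map, the join of the maps $\theta_{\kappa_i}$, and $\theta_\iota$, and with lower path $$L_\iota\times\Bigl(\prod_i L_{\kappa_i}\times\bigl(*_iX^{*\kappa_i}\bigr)\Bigr)\longrightarrow L_{\Sigma\kappa}\times X^{*\Sigma\kappa}\longrightarrow X,$$ given by the operad composition together with the associativity map of joins, and $\theta_{\Sigma\kappa}$. Then: 1. All arrows are maps of spaces over $BG$ (in particular continuous). 2. The diagram commutes on the nose, both for the spaces and for the covering maps of $G$-bundles. 3. It does so equivariantly: every arrow commutes, on spaces and on bundles, with the relabelling of all corners along bijections $e:\iota'\cong\iota$ and $f_j:\kappa'_j\cong\kappa_{e(j)}$, where relabelling acts trivially on $X$. For $\iota'=\iota$ and all $\kappa_i=\kappa'_i$ equal to a fixed $m$-element set, this is equivariance for $\Sigma_n\wr\Sigma_m$, $n=|\iota|$; for $n=m=2$ it is the $\Sigma_2\wr\Sigma_2$ case. 4. For $\iota=\{1,\dots,n\}$ and $\kappa_i=\{1,\dots,m_i\}$ the diagram also commutes with the corner $L_{\Sigma\kappa}\times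 X^{*\Sigma\kappa}$ replaced by $L_{m_1+\dots+m_n}\times X^{*(m_1+\dots+m_n)}$ along the lexicographic bijection. -/

import Mathlib

noncomputable section

namespace JoinOperad

/-! ### The space `R^∞` and the linear isometries operad -/

/-- The finitely supported real sequences, as a subspace of `ℓ²`. -/
def finSeq : Submodule ℝ (lp (fun _ : ℕ => ℝ) 2) where
  carrier := {x | (Function.support (fun n => x n)).Finite}
  zero_mem' := by simp
  add_mem' := by
    intro a b ha hb
    refine (Set.Finite.union ha hb).subset ?_
    intro n hn
    simp only [Set.mem_union, Function.mem_support, lp.coeFn_add, Pi.add_apply] at hn ⊢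
    by_contra! h
    exact hn (by rw [h.1, h.2, add_zero])
  smul_mem' := by
    intro c x hx
    refine Set.Finite.subset hx ?_
    intro n hn
    simp only [Function.mem_support, lp.coeFn_smul, Pi.smul_apply, smul_eq_mul] at hn ⊢
    exact right_ne_zero_of_mul hn

/-- `R^∞`: the finitely supported real sequences, with the standard inner product. -/
def RInf : Type := finSeq

instance : NormedAddCommGroup RInf := inferInstanceAs (NormedAddCommGroup finSeq)

instance : InnerProductSpace ℝ RInf := inferInstanceAs (InnerProductSpace ℝ finSeq)

/-- The space of linear isometric embeddings of the orthogonal sum of copies of `R^∞` indexed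
by `ι` into `R^∞`. The `n`-th space of the linear isometries operad is `LIso (Fin n)`. -/
abbrev LIso (ι : Type*) [Fintype ι] : Type _ :=
  PiLp 2 (fun _ : ι => RInf) →ₗᵢ[ℝ] RInf

/-- The underlying continuous map of a linear isometric embedding. -/
def LIso.toContinuousMap {ι : Type*} [Fintype ι] (l : LIso ι) :
    C(PiLp 2 (fun _ : ι => RInf), RInf) :=
  ⟨l, l.continuous⟩

/-- `LIso ι` carries the compact-open topology. -/
instance (ι : Type*) [Fintype ι] : TopologicalSpace (LIso ι) :=
  TopologicalSpace.induced LIso.toContinuousMap inferInstance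

/-- Relabelling of inputs along a bijection `e : ι' ≃ ι`. For `ι' = ι` this is the (right)
action of the symmetric group on the operad. -/
def LIso.relabel {ι ι' : Type*} [Fintype ι] [Fintype ι'] (e : ι' ≃ ι) (l : LIso ι) : LIso ι' :=
  LinearIsometry.comp l (LinearIsometryEquiv.piLpCongrLeft 2 ℝ RInf e).toLinearIsometry

/-- The orthogonal sum `(x_{i,a}) ↦ (m_i ((x_{i,a})_a))_i` of a family of linear isometric
embeddings. -/
def LIso.sum {ι : Type*} {κ : ι → Type*} [Fintype ι] [∀ i, Fintype (κ i)]
    (m : ∀ i, LIso (κ i)) :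
    PiLp 2 (fun _ : (Σ i, κ i) => RInf) →ₗᵢ[ℝ] PiLp 2 (fun _ : ι => RInf) where
  toFun x := WithLp.toLp 2 fun i =>
    m i (WithLp.toLp 2 fun a => x ⟨i, a⟩)
  map_add' x y := by
    ext1 i
    simp only [PiLp.add_apply]
    rw [← map_add]
    rfl
  map_smul' c x := by
    ext1 i
    simp only [PiLp.smul_apply, RingHom.id_apply]
    rw [← map_smul]
    rfl
  norm_map' x := by
    have h : ∀ i, ‖m i (WithLp.toLp 2 fun a => x ⟨i, a⟩)‖ ^ 2
        = ∑ a, ‖x ⟨i, a⟩‖ ^ 2 := by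
      intro i
      rw [LinearIsometry.norm_map, PiLp.norm_sq_eq_of_L2]
    have : ‖WithLp.toLp 2 fun i =>
        m i (WithLp.toLp 2 fun a => x ⟨i, a⟩)‖ ^ 2 = ‖x‖ ^ 2 := by
      rw [PiLp.norm_sq_eq_of_L2, PiLp.norm_sq_eq_of_L2, Fintype.sum_sigma]
      exact Finset.sum_congr rfl fun i _ => h i
    exact (sq_eq_sq₀ (norm_nonneg _) (norm_nonneg _)).1 this

/-- The operadic composition `γ(l; (m_i)_i) = l ∘ (⊕ m_i)`. -/
def LIso.comp {ι : Type*} {κ : ι → Type*} [Fintype ι] [∀ i, Fintype (κ i)]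
    (l : LIso ι) (m : ∀ i, LIso (κ i)) : LIso (Σ i, κ i) :=
  LinearIsometry.comp l (LIso.sum m)

/-! ### Joins -/

/-- The join of a finite family of spaces: barycentric coordinates `wt`, and a point of `P i`
for each `i` whose coordinate is not zero. Where a coordinate vanishes, nothing of the
corresponding factor is remembered; in particular empty factors are neutral. -/
@[ext]
structure Join {ι : Type*} [Fintype ι] (P : ι → Type*) where
  wt : ι → ℝ
  nonneg : ∀ i, 0 ≤ wt i
  sum_one : ∑ i, wt i = 1
  pt : ∀ i, 0 < wt i → P i

/-- The topology of the join: the coarsest one for which all coordinates `wt i` and all the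
partially defined coordinates `pt i : {wt i > 0} → P i`, with open domains, are continuous. -/
instance {ι : Type*} [Fintype ι] (P : ι → Type*) [∀ i, TopologicalSpace (P i)] :
    TopologicalSpace (Join P) :=
  TopologicalSpace.induced Join.wt inferInstance ⊓
    ⨅ i, TopologicalSpace.generateFrom
      {s | ∃ U : Set (P i), IsOpen U ∧ s = {z | ∃ h : 0 < z.wt i, z.pt i h ∈ U}}

/-- A group acts diagonally on a join. -/
instance {G ι : Type*} [Group G] [Fintype ι] (P : ι → Type*) [∀ i, MulAction G (P i)] :
    MulAction G (Join P) where
  smul g z := ⟨z.wt, z.nonneg, z.sum_one, fun i h => g • z.pt i h⟩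
  one_smul z := by
    change Join.mk _ _ _ _ = z
    simp
  mul_smul g h z := by
    change Join.mk _ _ _ _ = Join.mk _ _ _ _
    congr 1
    funext i hi
    exact mul_smul g h (z.pt i hi)

/-- Functoriality of the join, with a simultaneous relabelling of the factors along a bijection
`e : ι' ≃ ι`. -/
def Join.relabel {ι ι' : Type*} [Fintype ι] [Fintype ι'] {P : ι → Type*} {P' : ι' → Type*}
    (e : ι' ≃ ι) (f : ∀ j, P (e j) → P' j) (z : Join P) : Join P' where
  wt j := z.wt (e j)
  nonneg j := z.nonneg (e j)
  sum_one := by rw [Equiv.sum_comp e z.wt, z.sum_one]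
  pt j h := f j (z.pt (e j) h)

/-- The join of a family of maps. -/
def Join.map {ι : Type*} [Fintype ι] {P P' : ι → Type*} (f : ∀ i, P i → P' i) :
    Join P → Join P' :=
  Join.relabel (Equiv.refl ι) f

/-- The associativity isomorphism from an iterated join to a single join; barycentric
coordinates are multiplied. -/
def Join.flatten {ι : Type*} {κ : ι → Type*} [Fintype ι] [∀ i, Fintype (κ i)]
    {P : (Σ i, κ i) → Type*} (z : Join fun i => Join fun a : κ i => P ⟨i, a⟩) : Join P where
  wt s := if h : 0 < z.wt s.1 then z.wt s.1 * (z.pt s.1 h).wt s.2 else 0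
  nonneg s := by
    split_ifs with h
    · exact mul_nonneg h.le ((z.pt s.1 h).nonneg s.2)
    · exact le_rfl
  sum_one := by
    rw [Fintype.sum_sigma, ← z.sum_one]
    refine Finset.sum_congr rfl fun i _ => ?_
    by_cases h : 0 < z.wt i
    · simp only [h, dite_true]
      rw [← Finset.mul_sum, (z.pt i h).sum_one, mul_one]
    · simp only [h, dite_false, Finset.sum_const_zero]
      exact le_antisymm (z.nonneg i) (not_lt.1 h)
  pt s hs :=
    have h : 0 < z.wt s.1 := by
      by_contra h
      simp [h] at hs
    (z.pt s.1 h).pt s.2 (by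
      simp only [h, dite_true] at hs
      exact pos_of_mul_pos_right hs h.le)

/-- The product `W × P` of a constant space `W` and a `G`-space `P`: the group acts on the second
factor only. -/
@[ext]
structure ConstProd (W P : Type*) where
  cst : W
  pt : P

/-- The product topology. -/
instance (W P : Type*) [TopologicalSpace W] [TopologicalSpace P] :
    TopologicalSpace (ConstProd W P) :=
  TopologicalSpace.induced (fun x => (x.cst, x.pt)) inferInstance

instance (G W P : Type*) [Group G] [MulAction G P] : MulAction G (ConstProd W P) where
  smul g x := ⟨x.cst, g • x.pt⟩
  one_smul x := ConstProd.ext rfl (one_smul G x.pt)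
  mul_smul g h x := ConstProd.ext rfl (mul_smul g h x.pt)

/-- The moving map `(∏ W_i) × (*_i Y_i) → *_i (W_i × Y_i)` for constant spaces `W_i`; the coordinate
in `W_i` is forgotten whenever the `i`-th barycentric coordinate vanishes. -/
def move {ι : Type*} [Fintype ι] {W Y : ι → Type*} (x : ConstProd (∀ i, W i) (Join Y)) :
    Join fun i => ConstProd (W i) (Y i) :=
  ⟨x.pt.wt, x.pt.nonneg, x.pt.sum_one, fun i h => ⟨x.cst i, x.pt.pt i h⟩⟩

/-! ### The Stiefel space and its quotient `BG` -/

/-- The space of orthonormal `k`-frames in `R^∞`. -/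
@[ext]
structure Stiefel (k : ℕ) where
  frame : Fin k → RInf
  orthonormal : Orthonormal ℝ frame

/-- The topology of a subspace of `(R^∞)^k`. -/
instance (k : ℕ) : TopologicalSpace (Stiefel k) :=
  TopologicalSpace.induced Stiefel.frame inferInstance

theorem orthonormal_subst {k : ℕ} (A : Matrix (Fin k) (Fin k) ℝ) (hA : A * A.transpose = 1)
    (v : Fin k → RInf) (hv : Orthonormal ℝ v) : Orthonormal ℝ fun j => ∑ i, A j i • v i := by
  rw [orthonormal_iff_ite] at hv ⊢
  intro a b
  have h := congrFun (congrFun hA a) b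
  rw [Matrix.mul_apply, Matrix.one_apply] at h
  rw [← h, sum_inner]
  refine Finset.sum_congr rfl fun i _ => ?_
  rw [inner_sum, Finset.sum_eq_single i]
  · rw [real_inner_smul_left, real_inner_smul_right, hv]
    simp
  · intro l _ hl
    rw [real_inner_smul_left, real_inner_smul_right, hv]
    simp [hl.symm]
  · simp

/-- `O(k)`, hence each of its subgroups, acts on frames by linear substitution. -/
instance (k : ℕ) : MulAction (Matrix.orthogonalGroup (Fin k) ℝ) (Stiefel k) where
  smul g v := ⟨fun j => ∑ i, g.1 j i • v.frame i,
    orthonormal_subst g.1 ((Matrix.mem_orthogonalGroup_iff (Fin k) ℝ).1 g.2) v.frame v.orthonormal⟩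
  one_smul v := by
    apply Stiefel.ext
    funext j
    change ∑ i, (1 : Matrix (Fin k) (Fin k) ℝ) j i • v.frame i = v.frame j
    simp [Matrix.one_apply]
  mul_smul g h v := by
    apply Stiefel.ext
    funext j
    change ∑ i, (g.1 * h.1) j i • v.frame i = ∑ l, g.1 j l • ∑ i, h.1 l i • v.frame i
    simp only [Matrix.mul_apply, Finset.sum_smul, Finset.smul_sum, smul_smul]
    exact Finset.sum_comm

/-- The orbit space `P / G`. A space over `BG` is presented by the principal `G`-bundle `P`
pulled back from the Stiefel space, and is recovered as `P / G`. -/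
abbrev Base (G P : Type*) [Group G] [MulAction G P] : Type _ :=
  Quotient (MulAction.orbitRel G P)

/-- The projection of a bundle onto its base. -/
def Base.proj (G : Type*) {P : Type*} [Group G] [MulAction G P] : P → Base G P :=
  Quotient.mk _

/-- The map of orbit spaces induced by an equivariant map. -/
def Base.map {G P Q : Type*} [Group G] [MulAction G P] [MulAction G Q] (f : P → Q)
    (hf : ∀ (g : G) p, f (g • p) = g • f p) : Base G P → Base G Q :=
  Quotient.map f (by
    rintro a b ⟨g, rfl⟩
    exact ⟨g, (hf g b).symm⟩)

/-- The map `W × (P / G) → Q / G` induced by an equivariant map `W × P → Q`, for `W` constant. -/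
def Base.mapConst {G W P Q : Type*} [Group G] [MulAction G P] [MulAction G Q]
    (f : ConstProd W P → Q) (hf : ∀ (g : G) x, f (g • x) = g • f x)
    (x : W × Base G P) : Base G Q :=
  Base.map (fun p => f ⟨x.1, p⟩) (fun g p => hf g ⟨x.1, p⟩) x.2

/-! ### The structure maps -/

/-- The join of frames inside `R^∞`. For `l = (l_i)_i`, the point of the join with barycentric
coordinates `t_i` and frames `v_i` is sent to the frame `∑ i, √t_i • l_i(v_i)`. -/
def act {ι : Type*} [Fintype ι] {k : ℕ} (x : ConstProd (LIso ι) (Join fun _ : ι => Stiefel k)) :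
    Stiefel k :=
  ⟨fun j => x.cst (WithLp.toLp 2 fun i =>
      if h : 0 < x.pt.wt i then Real.sqrt (x.pt.wt i) • (x.pt.pt i h).frame j else 0), by
    rw [orthonormal_iff_ite]
    intro a b
    rw [LinearIsometry.inner_map_map, PiLp.inner_apply]
    have key : ∀ i, inner ℝ (if h : 0 < x.pt.wt i then Real.sqrt (x.pt.wt i) • (x.pt.pt i h).frame a else 0 : RInf)
        (if h : 0 < x.pt.wt i then Real.sqrt (x.pt.wt i) • (x.pt.pt i h).frame b else 0 : RInf)
        = x.pt.wt i * (if a = b then 1 else 0) := by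
      intro i
      by_cases h : 0 < x.pt.wt i
      · simp only [h, dite_true]
        rw [real_inner_smul_left, real_inner_smul_right,
          orthonormal_iff_ite.1 (x.pt.pt i h).orthonormal a b, ← mul_assoc, Real.mul_self_sqrt h.le]
      · have h0 : x.pt.wt i = 0 := le_antisymm (not_lt.1 h) (x.pt.nonneg i)
        simp [h0]
    calc _ = ∑ i, x.pt.wt i * (if a = b then 1 else 0) := Finset.sum_congr rfl fun i _ => key i
      _ = _ := by rw [← Finset.sum_mul, x.pt.sum_one, one_mul]⟩

section equivariance

variable {ι : Type*} [Fintype ι]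

theorem move_smul {G : Type*} [Group G] {W Y : ι → Type*} [∀ i, MulAction G (Y i)]
    (g : G) (x : ConstProd (∀ i, W i) (Join Y)) : move (g • x) = g • move x := rfl

theorem Join.relabel_smul {G ι' : Type*} [Group G] [Fintype ι'] {P : ι → Type*} {P' : ι' → Type*}
    [∀ i, MulAction G (P i)] [∀ j, MulAction G (P' j)] (e : ι' ≃ ι) (f : ∀ j, P (e j) → P' j)
    (hf : ∀ j (g : G) p, f j (g • p) = g • f j p) (g : G) (z : Join P) :
    Join.relabel e f (g • z) = g • Join.relabel e f z := by
  change Join.mk _ _ _ _ = Join.mk _ _ _ _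
  congr 1
  funext j h
  exact hf j g _

theorem Join.map_smul {G : Type*} [Group G] {P P' : ι → Type*}
    [∀ i, MulAction G (P i)] [∀ i, MulAction G (P' i)] (f : ∀ i, P i → P' i)
    (hf : ∀ i (g : G) p, f i (g • p) = g • f i p) (g : G) (z : Join P) :
    Join.map f (g • z) = g • Join.map f z :=
  Join.relabel_smul (Equiv.refl ι) f hf g z

theorem Join.flatten_smul {G : Type*} [Group G] {κ : ι → Type*} [∀ i, Fintype (κ i)]
    {P : (Σ i, κ i) → Type*} [∀ s, MulAction G (P s)] (g : G)
    (z : Join fun i => Join fun a : κ i => P ⟨i, a⟩) :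
    Join.flatten (g • z) = g • Join.flatten z := rfl

theorem act_smul {k : ℕ} (G : Subgroup (Matrix.orthogonalGroup (Fin k) ℝ)) (g : G)
    (x : ConstProd (LIso ι) (Join fun _ : ι => Stiefel k)) : act (g • x) = g • act x := by
  apply Stiefel.ext
  funext j
  change x.cst (WithLp.toLp 2 fun i =>
      if h : 0 < x.pt.wt i then Real.sqrt (x.pt.wt i) • ∑ l, g.1.1 j l • (x.pt.pt i h).frame l else 0)
    = ∑ l, g.1.1 j l • x.cst (WithLp.toLp 2 fun i =>
      if h : 0 < x.pt.wt i then Real.sqrt (x.pt.wt i) • (x.pt.pt i h).frame l else 0)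
  simp only [← map_smul, ← map_sum]
  congr 1
  ext1 i
  rw [WithLp.ofLp_sum, Finset.sum_apply]
  by_cases h : 0 < x.pt.wt i
  · simp only [h, dite_true, Finset.smul_sum, PiLp.smul_apply]
    exact Finset.sum_congr rfl fun l _ => smul_comm _ _ _
  · simp [h]

end equivariance

/-! ### The corners of the diagram

Write `X = BG`. All corners are products of constant spaces with spaces `P / G`, where the principal
`G`-bundle `P` is built from the Stiefel space by joins and products with constant spaces. -/

/-- The bundle over `X^{*ι}`. -/
abbrev Pow (k : ℕ) (ι : Type*) [Fintype ι] : Type _ := Join fun _ : ι => Stiefel k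

/-- The bundle over `L_ι × X^{*ι}`. -/
abbrev OpPow (k : ℕ) (ι : Type*) [Fintype ι] : Type _ := ConstProd (LIso ι) (Pow k ι)

/-- The bundle over `L_ι × (*_i (L_{κ i} × X^{*κ i}))`. -/
abbrev OpJoinOpPow (k : ℕ) {ι : Type*} (κ : ι → Type*) [Fintype ι] [∀ i, Fintype (κ i)] : Type _ :=
  ConstProd (LIso ι) (Join fun i => OpPow k (κ i))

/-- The bundle over `L_ι × ((∏_i L_{κ i}) × (*_i X^{*κ i}))`. -/
abbrev OpOpJoinPow (k : ℕ) {ι : Type*} (κ : ι → Type*) [Fintype ι] [∀ i, Fintype (κ i)] : Type _ :=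
  ConstProd (LIso ι) (ConstProd (∀ i, LIso (κ i)) (Join fun i => Pow k (κ i)))

section bundles

variable {k : ℕ} {ι ι' : Type*} [Fintype ι] [Fintype ι'] {κ : ι → Type*} {κ' : ι' → Type*}
  [∀ i, Fintype (κ i)] [∀ j, Fintype (κ' j)]

/-- `L_ι × (*_i (L_{κ i} × X^{*κ i})) → L_ι × X^{*ι}`, on bundles. -/
def topMap (x : OpJoinOpPow k κ) : OpPow k ι := ⟨x.cst, Join.map (fun _ => act) x.pt⟩

/-- `L_ι × ((∏_i L_{κ i}) × (*_i X^{*κ i})) → L_ι × (*_i (L_{κ i} × X^{*κ i}))`, on bundles. -/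
def leftMap (x : OpOpJoinPow k κ) : OpJoinOpPow k κ := ⟨x.cst, move x.pt⟩

/-- `L_ι × ((∏_i L_{κ i}) × (*_i X^{*κ i})) → L_{Σκ} × X^{*Σκ}`, on bundles. -/
def botMap (x : OpOpJoinPow k κ) : OpPow k (Σ i, κ i) :=
  ⟨LIso.comp x.cst x.pt.cst, Join.flatten x.pt.pt⟩

/-- Permutation (relabelling) of `X^{*ι}`, on bundles. -/
def Pow.relabel (e : ι' ≃ ι) : Pow k ι → Pow k ι' := Join.relabel e fun _ => id

/-- Permutation of `L_ι × X^{*ι}`, on bundles. -/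
def OpPow.relabel (e : ι' ≃ ι) (x : OpPow k ι) : OpPow k ι' :=
  ⟨LIso.relabel e x.cst, Pow.relabel e x.pt⟩

/-- Block permutation, by `e` of the blocks and by `f j` inside the blocks, of
`L_ι × (*_i (L_{κ i} × X^{*κ i}))`, on bundles. -/
def OpJoinOpPow.relabel (e : ι' ≃ ι) (f : ∀ j, κ' j ≃ κ (e j)) (x : OpJoinOpPow k κ) :
    OpJoinOpPow k κ' :=
  ⟨LIso.relabel e x.cst, Join.relabel e (fun j => OpPow.relabel (f j)) x.pt⟩

/-- Block permutation of `L_ι × ((∏_i L_{κ i}) × (*_i X^{*κ i}))`, on bundles. -/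
def OpOpJoinPow.relabel (e : ι' ≃ ι) (f : ∀ j, κ' j ≃ κ (e j)) (x : OpOpJoinPow k κ) :
    OpOpJoinPow k κ' :=
  ⟨LIso.relabel e x.cst, fun j => LIso.relabel (f j) (x.pt.cst (e j)),
    Join.relabel e (fun j => Pow.relabel (f j)) x.pt.pt⟩

end bundles

section spaces

variable {k : ℕ} (G : Subgroup (Matrix.orthogonalGroup (Fin k) ℝ))
  {ι ι' : Type*} [Fintype ι] [Fintype ι'] {κ : ι → Type*} {κ' : ι' → Type*}
  [∀ i, Fintype (κ i)] [∀ j, Fintype (κ' j)]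

/-- The classifying space `X = BG`. -/
abbrev BG : Type := Base G (Stiefel k)

/-- The structure map `L_ι × X^{*ι} → X`. -/
def actBG : LIso ι × Base G (Pow k ι) → BG G := Base.mapConst act (act_smul G)

/-- `L_ι × (*_i (L_{κ i} × X^{*κ i})) → L_ι × X^{*ι}`. -/
def topBG (x : LIso ι × Base G (Join fun i => OpPow k (κ i))) : LIso ι × Base G (Pow k ι) :=
  (x.1, Base.map (Join.map fun _ => act) (Join.map_smul _ fun _ => act_smul G) x.2)

/-- `L_ι × ((∏_i L_{κ i}) × (*_i X^{*κ i})) → L_ι × (*_i (L_{κ i} × X^{*κ i}))`. -/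
def leftBG (x : LIso ι × ((∀ i, LIso (κ i)) × Base G (Join fun i => Pow k (κ i)))) :
    LIso ι × Base G (Join fun i => OpPow k (κ i)) :=
  (x.1, Base.mapConst move move_smul x.2)

/-- `L_ι × ((∏_i L_{κ i}) × (*_i X^{*κ i})) → L_{Σκ} × X^{*Σκ}`. -/
def botBG (x : LIso ι × ((∀ i, LIso (κ i)) × Base G (Join fun i => Pow k (κ i)))) :
    LIso (Σ i, κ i) × Base G (Pow k (Σ i, κ i)) :=
  (LIso.comp x.1 x.2.1, Base.map Join.flatten (Join.flatten_smul (P := fun _ => Stiefel k)) x.2.2)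

theorem Pow.relabel_smul (e : ι' ≃ ι) (g : G) (z : Pow k ι) :
    Pow.relabel e (g • z) = g • Pow.relabel e z := rfl

theorem OpPow.relabel_smul (e : ι' ≃ ι) (g : G) (x : OpPow k ι) :
    OpPow.relabel e (g • x) = g • OpPow.relabel e x := rfl

/-- Permutation of `L_ι × X^{*ι}`. -/
def opPowRelabel (e : ι' ≃ ι) (x : LIso ι × Base G (Pow k ι)) : LIso ι' × Base G (Pow k ι') :=
  (LIso.relabel e x.1, Base.map (Pow.relabel e) (Pow.relabel_smul G e) x.2)

/-- Block permutation of `L_ι × (*_i (L_{κ i} × X^{*κ i}))`. -/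
def opJoinOpPowRelabel (e : ι' ≃ ι) (f : ∀ j, κ' j ≃ κ (e j))
    (x : LIso ι × Base G (Join fun i => OpPow k (κ i))) :
    LIso ι' × Base G (Join fun j => OpPow k (κ' j)) :=
  (LIso.relabel e x.1, Base.map (Join.relabel e fun j => OpPow.relabel (f j))
    (Join.relabel_smul e _ fun j => OpPow.relabel_smul G (f j)) x.2)

/-- Block permutation of `L_ι × ((∏_i L_{κ i}) × (*_i X^{*κ i}))`. -/
def opOpJoinPowRelabel (e : ι' ≃ ι) (f : ∀ j, κ' j ≃ κ (e j))
    (x : LIso ι × ((∀ i, LIso (κ i)) × Base G (Join fun i => Pow k (κ i)))) :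
    LIso ι' × ((∀ j, LIso (κ' j)) × Base G (Join fun j => Pow k (κ' j))) :=
  (LIso.relabel e x.1, fun j => LIso.relabel (f j) (x.2.1 (e j)),
    Base.map (Join.relabel e fun j => Pow.relabel (f j))
      (Join.relabel_smul e _ fun j => Pow.relabel_smul G (f j)) x.2.2)

/-- The bundle projection of a product with a constant space. -/
def projConst {W P B : Type*} (q : P → B) (x : ConstProd W P) : W × B := (x.cst, q x.pt)

end spaces

/-- A map of spaces over `BG`: a continuous map `F` of the bases that is covered by the continuous
`G`-equivariant map `F'` of the principal bundles pulled back from the Stiefel space. -/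
structure IsMapOver (G : Type*) [Group G] {P Q A B : Type*} [MulAction G P] [MulAction G Q]
    [TopologicalSpace P] [TopologicalSpace Q] [TopologicalSpace A] [TopologicalSpace B]
    (p : P → A) (q : Q → B) (F' : P → Q) (F : A → B) : Prop where
  continuous_total : Continuous F'
  equivariant : ∀ (g : G) x, F' (g • x) = g • F' x
  continuous_base : Continuous F
  covers : ∀ x, q (F' x) = F (p x)

end JoinOperad

end

namespace JoinOperad

/-! ### Continuity of maps defined on the locus where a coordinate is positive -/

/-! Commutativity is the identity √(t s) = √t √s. With outer weights t_i, inner weights s_{ia} and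
frames v_{ia}, the upper path gives l((√t_i · m_i((√s_{ia} v_{ia})_a))_i) and the lower path gives
l((m_i((√(t_i s_{ia}) v_{ia})_a))_i); these agree by linearity of m_i, and a vanishing weight
contributes 0 on both sides (`act_topMap_leftMap`). Relabelling reindexes the isometry and the join
in opposite directions, so the two cancel in `act` (`act_relabel`).

The analytic work is continuity. The join has an initial topology, so a map into it is tested on
weights, and on points only where the weight is positive (`Join.continuous_of`). Expressions defined
for positive weight extend continuously by 0 because their norms are bounded by a function vanishing
with the weight (`continuous_dite_pos`). Evaluation of isometries is jointly continuous, although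
`RInf` is not locally compact (`LIso.continuous_eval`). Continuity on bundles descends to orbit
spaces, also with a constant factor, because orbit projections are open
(`Base.continuous_mapConst`). Identities descend by choosing representatives. -/

/-- An open subset of the open locus `0 < t` is open in the whole space. Preimages of the subbasic
sets of the join topology have this form. -/
theorem isOpen_exists_pos {Z Y : Type*} [TopologicalSpace Z] [TopologicalSpace Y] {t : Z → ℝ}
    (ht : Continuous t) (F : ∀ z, 0 < t z → Y)
    (hF : Continuous fun z : {z // 0 < t z} => F z.1 z.2) {U : Set Y} (hU : IsOpen U) :
    IsOpen {z | ∃ h : 0 < t z, F z h ∈ U} := by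
  have ho : IsOpen {z | 0 < t z} := isOpen_lt continuous_const ht
  convert ho.isOpenMap_subtype_val _ (hU.preimage hF) using 1
  ext z
  simp

/-- On the open locus `0 < t` continuity is local. At any other point φ is 0, and φ dominates the
norm everywhere, so the extension by zero is squeezed to 0. -/
theorem continuous_dite_pos {Z E : Type*} [TopologicalSpace Z] [NormedAddCommGroup E] {t φ : Z → ℝ}
    (ht : Continuous t) (hφ : Continuous φ) (h0 : ∀ z, ¬ 0 < t z → φ z = 0)
    (F : ∀ z, 0 < t z → E) (hF : Continuous fun z : {z // 0 < t z} => F z.1 z.2)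
    (hb : ∀ z h, ‖F z h‖ ≤ φ z) :
    Continuous fun z => if h : 0 < t z then F z h else 0 := by
  have hb' : ∀ z, ‖if h : 0 < t z then F z h else 0‖ ≤ φ z := by
    intro z
    by_cases h : 0 < t z
    · simpa [h] using hb z h
    · simp [h, h0 z h]
  rw [continuous_iff_continuousAt]
  intro z
  by_cases h : 0 < t z
  · have ho : IsOpen {z | 0 < t z} := isOpen_lt continuous_const ht
    refine (ho.isOpenEmbedding_subtypeVal.continuousAt_iff (x := ⟨z, h⟩)).1 ?_
    refine (hF.congr fun w => ?_).continuousAt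
    simp [w.2]
  · have : Filter.Tendsto φ (nhds z) (nhds 0) := by
      have := hφ.tendsto z
      rwa [h0 z h] at this
    simpa [ContinuousAt, h] using squeeze_zero_norm hb' this

/-! ### The topology of the join -/

section join

variable {ι : Type*} [Fintype ι] {P : ι → Type*} [∀ i, TopologicalSpace (P i)]

theorem Join.continuous_wt : Continuous (Join.wt : Join P → ι → ℝ) :=
  continuous_iff_le_induced.2 inf_le_left

theorem Join.continuous_wt_apply (i : ι) : Continuous fun z : Join P => z.wt i :=
  (continuous_apply i).comp Join.continuous_wt

/-- The coarsest topology on the join for which the partially defined coordinate `pt i` is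
continuous with open domain. -/
abbrev Join.ptTopology (P : ι → Type*) [∀ i, TopologicalSpace (P i)] (i : ι) :
    TopologicalSpace (Join P) :=
  TopologicalSpace.generateFrom
    {s | ∃ U : Set (P i), IsOpen U ∧ s = {z | ∃ h : 0 < z.wt i, z.pt i h ∈ U}}

theorem Join.topology_eq : (inferInstance : TopologicalSpace (Join P)) =
    TopologicalSpace.induced Join.wt inferInstance ⊓ ⨅ i, Join.ptTopology P i := rfl

theorem Join.isOpen_pt (i : ι) {U : Set (P i)} (hU : IsOpen U) :
    IsOpen {z : Join P | ∃ h : 0 < z.wt i, z.pt i h ∈ U} := by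
  have hle : (inferInstance : TopologicalSpace (Join P)) ≤ Join.ptTopology P i :=
    Join.topology_eq.trans_le (inf_le_right.trans (iInf_le (Join.ptTopology P) i))
  exact hle _ (TopologicalSpace.isOpen_generateFrom_of_mem ⟨U, hU, rfl⟩)

/-- Taking an arbitrary `g` with values in the positive locus, rather than the inclusion of that
locus, lets the lemma be iterated on nested joins. -/
theorem Join.continuous_pt {Z : Type*} [TopologicalSpace Z] {g : Z → Join P} (hg : Continuous g)
    (i : ι) (h : ∀ z, 0 < (g z).wt i) : Continuous fun z => (g z).pt i (h z) := by
  refine continuous_def.2 fun U hU => ?_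
  have hs : (fun z => (g z).pt i (h z)) ⁻¹' U =
      g ⁻¹' {z : Join P | ∃ h : 0 < z.wt i, z.pt i h ∈ U} :=
    Set.ext fun z => ⟨fun hz => ⟨h z, hz⟩, fun ⟨_, hz⟩ => hz⟩
  rw [hs]
  exact (Join.isOpen_pt i hU).preimage hg

/-- The universal property of the initial topology: nothing has to be checked about points where the
weight vanishes. -/
theorem Join.continuous_of {Z : Type*} [TopologicalSpace Z] {g : Z → Join P}
    (hw : ∀ i, Continuous fun z => (g z).wt i)
    (hp : ∀ i, Continuous fun z : {z // 0 < (g z).wt i} => (g z.1).pt i z.2) : Continuous g := by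
  refine continuous_inf_rng.2 ⟨continuous_induced_rng.2 (continuous_pi hw),
    (continuous_iInf_rng (t₂ := Join.ptTopology P)).2 fun i => continuous_generateFrom_iff.2 ?_⟩
  rintro _ ⟨U, hU, rfl⟩
  exact isOpen_exists_pos (hw i) (fun z h => (g z).pt i h) (hp i) hU

theorem Join.continuous_relabel {ι' : Type*} [Fintype ι'] {P' : ι' → Type*}
    [∀ j, TopologicalSpace (P' j)] (e : ι' ≃ ι) {f : ∀ j, P (e j) → P' j}
    (hf : ∀ j, Continuous (f j)) : Continuous (Join.relabel e f) :=
  Join.continuous_of (fun j => Join.continuous_wt_apply (e j)) fun j =>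
    (hf j).comp (Join.continuous_pt continuous_subtype_val (e j) fun z => z.2)

theorem Join.continuous_map {P' : ι → Type*} [∀ i, TopologicalSpace (P' i)] {f : ∀ i, P i → P' i}
    (hf : ∀ i, Continuous (f i)) : Continuous (Join.map f) :=
  Join.continuous_relabel (Equiv.refl ι) hf

theorem Join.wt_le_one {P : ι → Type*} (z : Join P) (i : ι) : z.wt i ≤ 1 :=
  z.sum_one ▸ Finset.single_le_sum (fun j _ => z.nonneg j) (Finset.mem_univ i)

theorem Join.wt_eq_zero {P : ι → Type*} (z : Join P) {i : ι} (h : ¬ 0 < z.wt i) : z.wt i = 0 :=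
  le_antisymm (not_lt.1 h) (z.nonneg i)

theorem Join.flatten_wt_of_pos {κ : ι → Type*} [∀ i, Fintype (κ i)] {P : (Σ i, κ i) → Type*}
    (z : Join fun i => Join fun a : κ i => P ⟨i, a⟩) {s : Σ i, κ i} (h : 0 < z.wt s.1) :
    (Join.flatten z).wt s = z.wt s.1 * (z.pt s.1 h).wt s.2 := dif_pos h

theorem Join.pos_of_flatten_wt_pos {κ : ι → Type*} [∀ i, Fintype (κ i)] {P : (Σ i, κ i) → Type*}
    (z : Join fun i => Join fun a : κ i => P ⟨i, a⟩) {s : Σ i, κ i}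
    (hs : 0 < (Join.flatten z).wt s) : 0 < z.wt s.1 := by
  by_contra h
  simp [Join.flatten, h] at hs

/-- The inner weight is undefined where the outer one vanishes, but it is at most 1, so the product
is bounded by the outer weight and tends to 0 there. -/
theorem Join.continuous_flatten {κ : ι → Type*} [∀ i, Fintype (κ i)] {P : (Σ i, κ i) → Type*}
    [∀ s, TopologicalSpace (P s)] :
    Continuous (Join.flatten : (Join fun i => Join fun a : κ i => P ⟨i, a⟩) → Join P) := by
  refine Join.continuous_of (fun s => ?_) fun s => ?_
  · refine continuous_dite_pos 
      (t := fun z : Join fun i => Join fun a : κ i => P ⟨i, a⟩ => z.wt s.1)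
      (φ := fun z => z.wt s.1)
      (Join.continuous_wt_apply s.1) (Join.continuous_wt_apply s.1) (fun z => z.wt_eq_zero)
      (fun z h => z.wt s.1 * (z.pt s.1 h).wt s.2) ?_ fun z h => ?_
    · exact ((Join.continuous_wt_apply s.1).comp continuous_subtype_val).mul
        ((Join.continuous_wt_apply s.2).comp
          (Join.continuous_pt continuous_subtype_val s.1 fun z => z.2))
    · rw [Real.norm_of_nonneg (mul_nonneg h.le ((z.pt s.1 h).nonneg s.2))]
      exact mul_le_of_le_one_right h.le (Join.wt_le_one _ _)
  -- A positive product forces both weights to be positive, so the outer and then the inner point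
  -- may be read off continuously.
  · have h (z : {z : Join fun i => Join fun a : κ i => P ⟨i, a⟩ //
        0 < (Join.flatten z).wt s}) : 0 < z.1.wt s.1 := Join.pos_of_flatten_wt_pos z.1 z.2
    exact Join.continuous_pt (Join.continuous_pt continuous_subtype_val s.1 h) s.2 fun z => by
      have hz := z.2
      rw [Join.flatten_wt_of_pos z.1 (h z)] at hz
      exact pos_of_mul_pos_right hz (h z).le

end join

/-! ### Products with constant spaces -/

section constProd

variable {W P : Type*} [TopologicalSpace W] [TopologicalSpace P]

theorem ConstProd.continuous_toProd :
    Continuous fun x : ConstProd W P => (x.cst, x.pt) := continuous_induced_dom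

theorem ConstProd.continuous_cst : Continuous (ConstProd.cst : ConstProd W P → W) :=
  continuous_fst.comp ConstProd.continuous_toProd

theorem ConstProd.continuous_pt : Continuous (ConstProd.pt : ConstProd W P → P) :=
  continuous_snd.comp ConstProd.continuous_toProd

theorem ConstProd.continuous_mk {Z : Type*} [TopologicalSpace Z] {a : Z → W} {b : Z → P}
    (ha : Continuous a) (hb : Continuous b) : Continuous fun z => ConstProd.mk (a z) (b z) :=
  continuous_induced_rng.2 (ha.prodMk hb)

/-- Forgetting the coordinate in `W i` at weight zero is harmless, since the join topology tests
points only at positive weight. -/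
theorem continuous_move {ι : Type*} [Fintype ι] {W Y : ι → Type*} [∀ i, TopologicalSpace (W i)]
    [∀ i, TopologicalSpace (Y i)] :
    Continuous (move : ConstProd (∀ i, W i) (Join Y) → Join fun i => ConstProd (W i) (Y i)) :=
  Join.continuous_of
    (fun i => (Join.continuous_wt_apply (P := Y) i).comp ConstProd.continuous_pt) fun i =>
    ConstProd.continuous_mk
      ((continuous_apply i).comp (ConstProd.continuous_cst.comp continuous_subtype_val))
      (Join.continuous_pt (ConstProd.continuous_pt.comp continuous_subtype_val) i fun z => z.2)

end constProd

/-! ### Continuity of the group actions -/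

section action

variable {G : Type*} [Group G]

instance {ι : Type*} [Fintype ι] {P : ι → Type*} [∀ i, TopologicalSpace (P i)]
    [∀ i, MulAction G (P i)] [∀ i, ContinuousConstSMul G (P i)] :
    ContinuousConstSMul G (Join P) :=
  ⟨fun g => Join.continuous_map (f := fun i => ((g • ·) : P i → P i)) fun _ =>
    continuous_const_smul g⟩

instance {W P : Type*} [TopologicalSpace W] [TopologicalSpace P] [MulAction G P]
    [ContinuousConstSMul G P] : ContinuousConstSMul G (ConstProd W P) :=
  ⟨fun g => ConstProd.continuous_mk ConstProd.continuous_cst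
    (ConstProd.continuous_pt.const_smul g)⟩

theorem Stiefel.continuous_frame {k : ℕ} (j : Fin k) : Continuous fun v : Stiefel k => v.frame j :=
  (continuous_apply j).comp continuous_induced_dom

instance (k : ℕ) : ContinuousConstSMul (Matrix.orthogonalGroup (Fin k) ℝ) (Stiefel k) :=
  ⟨fun g => continuous_induced_rng.2 <| continuous_pi fun j =>
    continuous_finsetSum Finset.univ (f := fun i (v : Stiefel k) => g.1 j i • v.frame i)
      fun i _ => (Stiefel.continuous_frame i).const_smul (g.1 j i)⟩

instance (k : ℕ) (G : Subgroup (Matrix.orthogonalGroup (Fin k) ℝ)) :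
    ContinuousConstSMul G (Stiefel k) :=
  ⟨fun g => continuous_const_smul g.1⟩

variable {P Q : Type*} [TopologicalSpace P] [TopologicalSpace Q] [MulAction G P] [MulAction G Q]

theorem Base.continuous_map {f : P → Q} (hf : ∀ (g : G) p, f (g • p) = g • f p)
    (hc : Continuous f) : Continuous (Base.map f hf) :=
  hc.quotient_map' _

/-- The saturation of an open set is a union of its translates, hence open; continuity of each
single translation suffices. -/
theorem Base.isOpenQuotientMap_proj [ContinuousConstSMul G P] :
    IsOpenQuotientMap (Base.proj G : P → Base G P) :=
  MulAction.isOpenQuotientMap_quotientMk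

/-- The product of a quotient map with an identity need not be a quotient map; for open quotient
maps it is, so continuity can be tested on `W × P`. -/
theorem Base.continuous_mapConst [ContinuousConstSMul G P] {W : Type*} [TopologicalSpace W]
    {f : ConstProd W P → Q} (hf : ∀ (g : G) x, f (g • x) = g • f x) (hc : Continuous f) :
    Continuous (Base.mapConst f hf) := by
  refine ((IsOpenQuotientMap.id (X := W)).prodMap
    (Base.isOpenQuotientMap_proj (G := G) (P := P))).continuous_comp_iff.1 ?_
  exact (continuous_quotient_mk' (X := Q)).comp
    (hc.comp (ConstProd.continuous_mk continuous_fst continuous_snd))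

end action

/-! ### Continuity for the linear isometries operad -/

section operad

variable {ι : Type*} [Fintype ι]

theorem LIso.continuous_apply (x : PiLp 2 fun _ : ι => RInf) : Continuous fun l : LIso ι => l x :=
  (continuous_eval_const (F := C(PiLp 2 fun _ : ι => RInf, RInf)) x).comp
    (continuous_induced_dom (f := LIso.toContinuousMap))

/-- Evaluation is jointly continuous because isometries are equicontinuous. -/
theorem LIso.continuous_eval :
    Continuous fun p : LIso ι × (PiLp 2 fun _ : ι => RInf) => p.1 p.2 := by
  rw [continuous_iff_continuousAt]
  rintro ⟨l, x⟩
  have h1 : Filter.Tendsto (fun p : LIso ι × (PiLp 2 fun _ : ι => RInf) => p.1 x)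
      (nhds (l, x)) (nhds (l x)) :=
    ((LIso.continuous_apply x).comp continuous_fst).tendsto (l, x)
  -- Split l'(y) = l'(x) + l'(y - x); the second term has norm ‖y - x‖ whatever the isometry l'.
  have h2 : Filter.Tendsto (fun p : LIso ι × (PiLp 2 fun _ : ι => RInf) => p.1 (p.2 - x))
      (nhds (l, x)) (nhds 0) := by
    have : Filter.Tendsto (fun p : LIso ι × (PiLp 2 fun _ : ι => RInf) => ‖p.2 - x‖)
        (nhds (l, x)) (nhds 0) := by
      have hc : Continuous fun p : LIso ι × (PiLp 2 fun _ : ι => RInf) => ‖p.2 - x‖ := by fun_prop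
      simpa using hc.tendsto (l, x)
    exact squeeze_zero_norm (fun p => (p.1.norm_map _).le) this
  simpa [ContinuousAt] using h1.add h2

/-- Currying into the compact-open topology needs no local compactness. -/
theorem LIso.continuous_of {Z : Type*} [TopologicalSpace Z] {g : Z → LIso ι}
    (hg : Continuous fun p : Z × (PiLp 2 fun _ : ι => RInf) => g p.1 p.2) : Continuous g :=
  continuous_induced_rng.2 (ContinuousMap.continuous_of_continuous_uncurry _ hg)

theorem LIso.continuous_comp {κ : ι → Type*} [∀ i, Fintype (κ i)] :
    Continuous fun p : LIso ι × (∀ i, LIso (κ i)) => LIso.comp p.1 p.2 := by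
  refine LIso.continuous_of (LIso.continuous_eval.comp
    ((continuous_fst.comp continuous_fst).prodMk ((PiLp.continuous_toLp 2 _).comp
      (continuous_pi fun i => LIso.continuous_eval.comp (Continuous.prodMk ?_ ?_)))))
  · exact (_root_.continuous_apply i).comp (continuous_snd.comp continuous_fst)
  · exact (PiLp.continuous_toLp 2 _).comp
      (continuous_pi fun a => (PiLp.continuous_apply 2 _ _).comp continuous_snd)

theorem Stiefel.norm_frame {k : ℕ} (v : Stiefel k) (j : Fin k) : ‖v.frame j‖ = 1 :=
  v.orthonormal.1 j

/-- Frame vectors are unit vectors, so the i-th summand has norm √t_i, which serves as the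
dominating function at weight zero. -/
theorem continuous_act {k : ℕ} : Continuous (act : OpPow k ι → Stiefel k) := by
  refine continuous_induced_rng.2 (continuous_pi fun j => LIso.continuous_eval.comp
    (ConstProd.continuous_cst.prodMk ((PiLp.continuous_toLp 2 _).comp (continuous_pi fun i => ?_))))
  have hw : Continuous fun x : OpPow k ι => x.pt.wt i :=
    (Join.continuous_wt_apply i).comp ConstProd.continuous_pt
  refine continuous_dite_pos hw (φ := fun x => Real.sqrt (x.pt.wt i)) hw.sqrt (fun x h => by rw [x.pt.wt_eq_zero h, Real.sqrt_zero])
    (fun x h => Real.sqrt (x.pt.wt i) • (x.pt.pt i h).frame j) ?_ fun x h => ?_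
  · exact (hw.sqrt.comp continuous_subtype_val).smul
      ((Stiefel.continuous_frame j).comp
        (Join.continuous_pt (ConstProd.continuous_pt.comp continuous_subtype_val) i fun z => z.2))
  · rw [norm_smul, Stiefel.norm_frame, mul_one, Real.norm_of_nonneg (Real.sqrt_nonneg _)]

end operad

/-! ### Commutativity and equivariance on bundles -/

section bundles

variable {k : ℕ} {ι ι' : Type*} [Fintype ι] [Fintype ι'] {κ : ι → Type*} {κ' : ι' → Type*}
  [∀ i, Fintype (κ i)] [∀ j, Fintype (κ' j)]

theorem act_topMap_leftMap (x : OpOpJoinPow k κ) : act (topMap (leftMap x)) = act (botMap x) := by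
  apply Stiefel.ext
  funext j
  refine congrArg x.cst (PiLp.ext fun i => ?_)
  change (if h : 0 < x.pt.pt.wt i then Real.sqrt (x.pt.pt.wt i) •
      x.pt.cst i (WithLp.toLp 2 fun a => if h' : 0 < (x.pt.pt.pt i h).wt a then
        Real.sqrt ((x.pt.pt.pt i h).wt a) • ((x.pt.pt.pt i h).pt a h').frame j else 0) else 0)
    = x.pt.cst i (WithLp.toLp 2 fun a => 
        if h : 0 < (Join.flatten (P := fun _ => Stiefel k) x.pt.pt).wt ⟨i, a⟩ then
          Real.sqrt ((Join.flatten (P := fun _ => Stiefel k) x.pt.pt).wt ⟨i, a⟩) •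
            ((Join.flatten (P := fun _ => Stiefel k) x.pt.pt).pt ⟨i, a⟩ h).frame j else 0)
  by_cases h : 0 < x.pt.pt.wt i
  · rw [dif_pos h, ← map_smul]
    refine congrArg (x.pt.cst i) (PiLp.ext fun a => ?_)
    have hw := Join.flatten_wt_of_pos (P := fun _ => Stiefel k) x.pt.pt (s := ⟨i, a⟩) h
    simp only [PiLp.smul_apply]
    by_cases h' : 0 < (x.pt.pt.pt i h).wt a
    · have hf : 0 < (Join.flatten (P := fun _ => Stiefel k) x.pt.pt).wt ⟨i, a⟩ :=
        hw ▸ mul_pos h h'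
      -- After √(t s) = √t √s the scalars agree; the frames agree by definition of `Join.flatten`.
      rw [dif_pos h', dif_pos hf, hw, Real.sqrt_mul h.le, smul_smul]
      rfl
    · have hf : ¬ 0 < (Join.flatten (P := fun _ => Stiefel k) x.pt.pt).wt ⟨i, a⟩ := by
        rw [hw]
        exact fun hp => h' (pos_of_mul_pos_right hp h.le)
      rw [dif_neg h', dif_neg hf, smul_zero]
  · have hf (a : κ i) : ¬ 0 < (Join.flatten (P := fun _ => Stiefel k) x.pt.pt).wt ⟨i, a⟩ :=
      fun hp => h (Join.pos_of_flatten_wt_pos (P := fun _ => Stiefel k) x.pt.pt hp)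
    simp only [h, hf, dite_false]
    exact (map_zero (x.pt.cst i)).symm

theorem act_relabel (e : ι' ≃ ι) (x : OpPow k ι) : act (x.relabel e) = act x := by
  apply Stiefel.ext
  funext j
  refine congrArg x.cst (PiLp.ext fun i => ?_)
  -- The left side is this summand at `e (e.symm i)`. The frame depends on a proof about the index,
  -- so the whole summand is transported at once.
  exact congrArg (fun i => if h : 0 < x.pt.wt i then
    Real.sqrt (x.pt.wt i) • (x.pt.pt i h).frame j else 0) (e.apply_symm_apply i)

/-- Permutations inside the blocks are absorbed by `act`; only the permutation of the blocks
survives. -/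
theorem topMap_relabel (e : ι' ≃ ι) (f : ∀ j, κ' j ≃ κ (e j)) (x : OpJoinOpPow k κ) :
    topMap (x.relabel e f) = (topMap x).relabel e := by
  refine ConstProd.ext rfl (Join.ext rfl (heq_of_eq ?_))
  funext j h
  exact act_relabel (f j) _

theorem botMap_relabel (e : ι' ≃ ι) (f : ∀ j, κ' j ≃ κ (e j)) (x : OpOpJoinPow k κ) :
    botMap (x.relabel e f) = (botMap x).relabel (Equiv.sigmaCongr e f) := by
  refine ConstProd.ext (LinearIsometry.ext fun v => ?_) rfl
  refine congrArg x.cst (PiLp.ext fun i => ?_)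
  -- Writing the block as `e j` makes `f j` applicable without transport between the types `κ i`.
  obtain ⟨j, rfl⟩ := e.surjective i
  change (fun j => x.pt.cst (e j) (WithLp.toLp 2 fun b => v ⟨j, (f j).symm b⟩)) (e.symm (e j))
    = x.pt.cst (e j) (WithLp.toLp 2 fun b => v ((Equiv.sigmaCongr e f).symm ⟨e j, b⟩))
  rw [e.symm_apply_apply]
  refine congrArg (x.pt.cst (e j)) (PiLp.ext fun b => congrArg v ?_)
  rw [eq_comm, Equiv.symm_apply_eq]
  simp [Equiv.sigmaCongr]

end bundles

/-! ### Commutativity and equivariance on spaces -/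

section spaces

variable {k : ℕ} (G : Subgroup (Matrix.orthogonalGroup (Fin k) ℝ))
  {ι ι' : Type*} [Fintype ι] [Fintype ι'] {κ : ι → Type*} {κ' : ι' → Type*}
  [∀ i, Fintype (κ i)] [∀ j, Fintype (κ' j)]

/-- Base maps are computed on representatives, so the identity on bundles descends. -/
theorem actBG_topBG_leftBG
    (x : LIso ι × ((∀ i, LIso (κ i)) × Base G (Join fun i => Pow k (κ i)))) :
    actBG G (topBG G (leftBG G x)) = actBG G (botBG G x) := by
  obtain ⟨l, m, ⟨z⟩⟩ := x
  exact congrArg (Base.proj G) (act_topMap_leftMap ⟨l, m, z⟩)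

theorem actBG_relabel (e : ι' ≃ ι) (x : LIso ι × Base G (Pow k ι)) :
    actBG G (opPowRelabel G e x) = actBG G x := by
  obtain ⟨l, ⟨z⟩⟩ := x
  exact congrArg (Base.proj G) (act_relabel e ⟨l, z⟩)

theorem topBG_relabel (e : ι' ≃ ι) (f : ∀ j, κ' j ≃ κ (e j))
    (x : LIso ι × Base G (Join fun i => OpPow k (κ i))) :
    topBG G (opJoinOpPowRelabel G e f x) = opPowRelabel G e (topBG G x) := by
  obtain ⟨l, ⟨z⟩⟩ := x
  exact congrArg (projConst (Base.proj G)) (topMap_relabel e f ⟨l, z⟩)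

theorem leftBG_relabel (e : ι' ≃ ι) (f : ∀ j, κ' j ≃ κ (e j))
    (x : LIso ι × ((∀ i, LIso (κ i)) × Base G (Join fun i => Pow k (κ i)))) :
    leftBG G (opOpJoinPowRelabel G e f x) = opJoinOpPowRelabel G e f (leftBG G x) := by
  obtain ⟨l, m, ⟨z⟩⟩ := x
  rfl

theorem botBG_relabel (e : ι' ≃ ι) (f : ∀ j, κ' j ≃ κ (e j))
    (x : LIso ι × ((∀ i, LIso (κ i)) × Base G (Join fun i => Pow k (κ i)))) :
    botBG G (opOpJoinPowRelabel G e f x) =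
      opPowRelabel G (Equiv.sigmaCongr e f) (botBG G x) := by
  obtain ⟨l, m, ⟨z⟩⟩ := x
  exact congrArg (projConst (Base.proj G)) (botMap_relabel e f ⟨l, m, z⟩)

/-! ### The arrows are maps of spaces over `BG` -/

theorem isMapOver_act : IsMapOver G (projConst (Base.proj G)) (Base.proj G)
    (act (ι := ι) (k := k)) (actBG G) where
  continuous_total := continuous_act
  equivariant := act_smul G
  continuous_base := Base.continuous_mapConst _ continuous_act
  covers _ := rfl

theorem isMapOver_topMap : IsMapOver G (projConst (Base.proj G)) (projConst (Base.proj G))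
    (topMap (κ := κ) (k := k)) (topBG G) where
  continuous_total := ConstProd.continuous_mk ConstProd.continuous_cst
    ((Join.continuous_map fun _ => continuous_act).comp ConstProd.continuous_pt)
  equivariant g x := congrArg (ConstProd.mk x.cst) (Join.map_smul _ (fun _ => act_smul G) g x.pt)
  continuous_base := continuous_fst.prodMk
    ((Base.continuous_map _ (Join.continuous_map fun _ => continuous_act)).comp continuous_snd)
  covers _ := rfl

theorem isMapOver_leftMap :
    IsMapOver G (projConst (projConst (Base.proj G))) (projConst (Base.proj G))
      (leftMap (κ := κ) (k := k)) (leftBG G) where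
  continuous_total := ConstProd.continuous_mk ConstProd.continuous_cst
    (continuous_move.comp ConstProd.continuous_pt)
  equivariant _ _ := rfl
  continuous_base := continuous_fst.prodMk
    ((Base.continuous_mapConst _ continuous_move).comp continuous_snd)
  covers _ := rfl

theorem isMapOver_botMap :
    IsMapOver G (projConst (projConst (Base.proj G))) (projConst (Base.proj G))
      (botMap (κ := κ) (k := k)) (botBG G) where
  continuous_total := ConstProd.continuous_mk
    (LIso.continuous_comp.comp (ConstProd.continuous_cst.prodMk
      (ConstProd.continuous_cst.comp ConstProd.continuous_pt)))
    (Join.continuous_flatten.comp (ConstProd.continuous_pt.comp ConstProd.continuous_pt))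
  equivariant _ _ := rfl
  continuous_base := (LIso.continuous_comp.comp
      (continuous_fst.prodMk (continuous_fst.comp continuous_snd))).prodMk
    ((Base.continuous_map _ Join.continuous_flatten).comp (continuous_snd.comp continuous_snd))
  covers _ := rfl

end spaces

end JoinOperad

open JoinOperad in
theorem mainTheorem6 (k : ℕ) (G : Subgroup (Matrix.orthogonalGroup (Fin k) ℝ))
    (hG : IsClosed (G : Set (Matrix.orthogonalGroup (Fin k) ℝ)))
    {ι ι' : Type*} [Fintype ι] [Fintype ι'] {κ : ι → Type*} {κ' : ι' → Type*}
    [∀ i, Fintype (κ i)] [∀ j, Fintype (κ' j)] (e : ι' ≃ ι) (f : ∀ j, κ' j ≃ κ (e j)) :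
    -- all arrows are maps of spaces over `BG`
    IsMapOver G (projConst (Base.proj G)) (Base.proj G)
      (act (ι := ι) (k := k)) (actBG G) ∧
    IsMapOver G (projConst (Base.proj G)) (projConst (Base.proj G))
      (topMap (κ := κ) (k := k)) (topBG G) ∧
    IsMapOver G (projConst (projConst (Base.proj G))) (projConst (Base.proj G))
      (leftMap (κ := κ) (k := k)) (leftBG G) ∧
    IsMapOver G (projConst (projConst (Base.proj G))) (projConst (Base.proj G))
      (botMap (κ := κ) (k := k)) (botBG G) ∧
    -- the diagram commutes, on spaces and on bundles
    (∀ x, actBG G (topBG (κ := κ) G (leftBG G x)) = actBG G (botBG G x)) ∧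
    (∀ x : OpOpJoinPow k κ, act (topMap (leftMap x)) = act (botMap x)) ∧
    -- all arrows are equivariant, on spaces
    (∀ x, actBG G (opPowRelabel G e x) = actBG G x) ∧
    (∀ x, topBG G (opJoinOpPowRelabel G e f x) = opPowRelabel G e (topBG G x)) ∧
    (∀ x, leftBG G (opOpJoinPowRelabel G e f x) = opJoinOpPowRelabel G e f (leftBG G x)) ∧
    (∀ x, botBG G (opOpJoinPowRelabel G e f x) =
      opPowRelabel G (Equiv.sigmaCongr e f) (botBG G x)) ∧
    -- all arrows are equivariant, on bundles
    (∀ x : OpPow k ι, act (x.relabel e) = act x) ∧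
    (∀ x : OpJoinOpPow k κ, topMap (x.relabel e f) = (topMap x).relabel e) ∧
    (∀ x : OpOpJoinPow k κ, leftMap (x.relabel e f) = (leftMap x).relabel e f) ∧
    (∀ x : OpOpJoinPow k κ,
      botMap (x.relabel e f) = (botMap x).relabel (Equiv.sigmaCongr e f)) ∧
    -- the diagram for the arities `n` and `m 1, …, m n`, with `L_{m 1 + ⋯ + m n}` as a corner
    (∀ (n : ℕ) (m : Fin n → ℕ)
      (x : LIso (Fin n) × ((∀ i, LIso (Fin (m i))) × Base G (Join fun i => Pow k (Fin (m i))))),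
      actBG G (topBG G (leftBG G x)) =
        actBG G (opPowRelabel G finSigmaFinEquiv.symm (botBG G x))) := by
  exact ⟨isMapOver_act G, isMapOver_topMap G, isMapOver_leftMap G, isMapOver_botMap G,
    actBG_topBG_leftBG G, act_topMap_leftMap, actBG_relabel G e, topBG_relabel G e f,
    leftBG_relabel G e f, botBG_relabel G e f, act_relabel e, topMap_relabel e f, fun _ => rfl,
    -- The structure map is invariant under relabelling, in particular along the lexicographic
    -- bijection, so the last diagram reduces to the one over the sigma type.
    botMap_relabel e f, fun n m x => by rw [actBG_relabel, actBG_topBG_leftBG]⟩
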